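/- Let $\alpha\in(1,2)$ and let $X$ be the totally asymmetric strictly $\alpha$-stable random variable with characteristic function $$\mathbb{E}\exp(itX)=\exp\left(\int_0^{\infty}\left(e^{itx}-1-itx\right)\frac{dx}{x^{\alpha+1}}\right),\qquad t\in\mathbb{R}.$$ For every $y\in\left[\frac{2}{\sqrt{2-\alpha}},\frac{2}{2-\alpha}\right]$ one has $$\mathbb{P}\left(X\le -y-\frac{1}{\alpha-1}\right)\le e^{4/3}e^{-\frac12(2-\alpha)y^2},$$ $$\mathbb{P}\left(X\le -\frac{1}{24}y-\frac{1}{\alpha-1}\right)\ge e^{-1}10^{-2}e^{-(2-\alpha)y^2}.$$ For every $y\ge\frac{2}{2-\alpha}$ one has $$\mathbb{P}\left(X\le -y-\frac{1}{\alpha-1}\right)\le\exp\left(-\frac{\left(\frac12\left(y+\frac{1}{\alpha-1}\right)\right)^{\alpha/(\alpha-1)}}{\left(\frac{1}{2-\alpha}+\frac{1}{\alpha-1}\right)^{1/(\alpha-1)}}\right),$$ $$\mathbb{P}\left(X\le -\left(\frac1e-\frac14\right)y-\frac{1}{\alpha-1}\right)\ge e^{-1}\exp\left(-\frac{\left(\sqrt{4-\frac2e}\left(y+\frac{1}{\alpha-1}\right)\right)^{\alpha/(\alpha-1)}}{\left(\frac{1}{2-\alpha}+\frac{1}{\alpha-1}\right)^{1/(\alpha-1)}}\right).$$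 -/

import Mathlib

open MeasureTheory ProbabilityTheory

/-- The characteristic exponent `∫₀^∞ (e^{itx} - 1 - itx) dx / x^{α+1}` of the strictly `α`-stable,
totally asymmetric law, `1 < α < 2`, whose Lévy measure is `x^{-α-1} dx` on `(0, ∞)`. -/
noncomputable def stableExponent (α t : ℝ) : ℂ :=
  ∫ x in Set.Ioi (0 : ℝ),
    (Complex.exp (Complex.I * t * x) - 1 - Complex.I * t * x) / ((x ^ (α + 1) : ℝ) : ℂ)

/-- `X` is a random variable on `(Ω, P)` with characteristic function
`E exp(itX) = exp(∫₀^∞ (e^{itx} - 1 - itx) dx / x^{α+1})`. -/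
structure IsTotallyAsymmetricStable {Ω : Type*} [MeasurableSpace Ω] (α : ℝ) (X : Ω → ℝ)
    (P : Measure Ω) : Prop where
  aemeasurable : AEMeasurable X P
  charFun_eq : ∀ t : ℝ, charFun (P.map X) t = Complex.exp (stableExponent α t)

/-!
Write `ν` for the Lévy measure `x^{-α-1} dx` and `ψ(s) = ∫ (e^{-sx} - 1 + sx) dν(x)`, so that
`ψ(s) = ψ(1) s ^ α`. The characteristic function of `-X` is the boundary value on the imaginary axis
of `exp ∘ ψ`, which is bounded and continuous on every strip `0 ≤ Re z ≤ s` and analytic inside it.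
Damping by a Gaussian, moving the contour from `Re z = 0` to `Re z = s` and removing the Gaussian
gives `E exp(-sX) = exp (ψ s)`.

The upper bounds are Chernoff's inequality, at the tilt `s = (2 - α) y` in the Gaussian range and at
the maximizer of `r s - ψ(s)` (with `ψ(1)` replaced by a simple bound) in the other one. The lower
bounds are the Paley–Zygmund inequality for `exp(-sX)` at the same kind of tilt; its price is the
factor `exp (-(ψ(2s) - 2ψ(s)))`. What remains is to bound `ψ` by elementary functions, splitting the
Lévy measure at `x = 1`.
-/

open Filter Topology Set
open scoped NNReal

section ContourShift

variable {E : Type*} [NormedAddCommGroup E] {F : ℂ → E} {g : ℝ → ℝ} {a b : ℝ}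

theorem integrable_verticalLine {σ : ℝ} {S : Set ℝ} (hF : ContinuousOn F (Complex.re ⁻¹' S))
    (hg : Integrable g) (hFg : ∀ z : ℂ, z.re ∈ S → ‖F z‖ ≤ g z.im) (hσ : σ ∈ S) :
    Integrable fun τ : ℝ => F (σ + τ * Complex.I) := by
  refine hg.mono' (Continuous.aestronglyMeasurable ?_) (.of_forall fun τ => ?_)
  · exact hF.comp_continuous (by fun_prop) fun τ => by simpa using hσ
  · simpa using hFg (σ + τ * Complex.I) (by simpa using hσ)

variable [NormedSpace ℂ E]

theorem tendsto_integral_horizontalSegment_zero (hab : a ≤ b)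
    (hg : Tendsto g (cocompact ℝ) (𝓝 0))
    (hFg : ∀ z : ℂ, z.re ∈ Icc a b → ‖F z‖ ≤ g z.im) :
    Tendsto (fun T : ℝ => ∫ σ in a..b, F (σ + T * Complex.I)) (cocompact ℝ) (𝓝 0) := by
  refine squeeze_zero_norm (fun T => ?_) (by simpa using hg.mul_const |b - a|)
  refine intervalIntegral.norm_integral_le_of_norm_le_const fun σ hσ => ?_
  rw [uIoc_of_le hab] at hσ
  simpa using hFg (σ + T * Complex.I) (by simpa using Ioc_subset_Icc_self hσ)

theorem integral_boundary_verticalStrip_eq_zero [CompleteSpace E] (hab : a < b)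
    (hF : DiffContOnCl ℂ F (Complex.re ⁻¹' Ioo a b)) (T : ℝ) :
    (∫ σ in a..b, F (σ + (-T : ℝ) * Complex.I)) - (∫ σ in a..b, F (σ + T * Complex.I)) +
      Complex.I • (∫ τ in (-T)..T, F (b + τ * Complex.I)) -
      Complex.I • (∫ τ in (-T)..T, F (a + τ * Complex.I)) = 0 := by
  have hcl : closure (Complex.re ⁻¹' Ioo a b) = Complex.re ⁻¹' Icc a b := by
    rw [Complex.closure_preimage_re, closure_Ioo hab.ne]
  refine Complex.integral_boundary_rect_eq_zero_of_continuousOn_of_differentiableOn F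
    (⟨a, -T⟩ : ℂ) (⟨b, T⟩ : ℂ) (hF.continuousOn.mono ?_) (hF.differentiableOn.mono ?_)
  · rw [hcl, uIcc_of_le hab.le]
    exact fun z hz => hz.1
  · simp only [min_eq_left hab.le, max_eq_right hab.le]
    exact fun z hz => hz.1

theorem integral_verticalLine_eq [CompleteSpace E] (hab : a < b)
    (hF : DiffContOnCl ℂ F (Complex.re ⁻¹' Ioo a b)) (hg : Integrable g)
    (hg₀ : Tendsto g (cocompact ℝ) (𝓝 0))
    (hFg : ∀ z : ℂ, z.re ∈ Icc a b → ‖F z‖ ≤ g z.im) :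
    ∫ τ : ℝ, F (a + τ * Complex.I) = ∫ τ : ℝ, F (b + τ * Complex.I) := by
  have hcont : ContinuousOn F (Complex.re ⁻¹' Icc a b) := by
    simpa only [Complex.closure_preimage_re, closure_Ioo hab.ne] using hF.continuousOn
  have hleft := intervalIntegral_tendsto_integral
    (integrable_verticalLine hcont hg hFg (left_mem_Icc.mpr hab.le))
    tendsto_neg_atTop_atBot tendsto_id
  have hright := intervalIntegral_tendsto_integral
    (integrable_verticalLine hcont hg hFg (right_mem_Icc.mpr hab.le))
    tendsto_neg_atTop_atBot tendsto_id
  have hhor := tendsto_integral_horizontalSegment_zero hab.le hg₀ hFg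
  have htop := hhor.mono_left atTop_le_cocompact
  have hbot := (hhor.mono_left atBot_le_cocompact).comp tendsto_neg_atTop_atBot
  have hlim := ((hbot.sub htop).add (hright.const_smul Complex.I)).sub
    (hleft.const_smul Complex.I)
  have hzero := tendsto_nhds_unique
    (hlim.congr fun T => integral_boundary_verticalStrip_eq_zero hab hF T) tendsto_const_nhds
  rw [sub_zero, zero_add, sub_eq_zero] at hzero
  exact (smul_right_injective E Complex.I_ne_zero hzero).symm

end ContourShift

section BoundedExtension

variable {G : ℂ → ℂ} {s B : ℝ}

theorem norm_cexp_sq_div_mul_le {v : ℝ} (hv : 0 < v) (hG : ∀ z : ℂ, z.re ∈ Icc 0 s → ‖G z‖ ≤ B)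
    {z : ℂ} (hz : z.re ∈ Icc 0 s) :
    ‖Complex.exp ((z - s) ^ 2 / (2 * v)) * G z‖ ≤
      Real.exp (s ^ 2 / (2 * v)) * B * Real.exp (-(1 / (2 * v)) * z.im ^ 2) := by
  have hre : ((z - s) ^ 2 / (2 * v : ℂ)).re =
      (z.re - s) ^ 2 / (2 * v) + -(1 / (2 * v)) * z.im ^ 2 := by
    rw [show (2 * v : ℂ) = ((2 * v : ℝ) : ℂ) by push_cast; rfl, Complex.div_ofReal_re]
    simp only [sq, Complex.mul_re, Complex.sub_re, Complex.sub_im, Complex.ofReal_re,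
      Complex.ofReal_im]
    ring
  have hsq : (z.re - s) ^ 2 ≤ s ^ 2 := by nlinarith [hz.1, hz.2]
  rw [norm_mul, Complex.norm_exp, hre, Real.exp_add, mul_right_comm]
  gcongr
  exact hG z hz

theorem cexp_ofReal_mul_I_sub_sq_div {v : ℝ} (hv : 0 < v) (s τ : ℝ) :
    Complex.exp ((τ * Complex.I - s) ^ 2 / (2 * v)) =
      Complex.exp (s ^ 2 / (2 * v)) * Real.exp (-τ ^ 2 / (2 * v)) *
        Complex.exp (-(τ * (s / v : ℝ)) * Complex.I) := by
  have hvC : (v : ℂ) ≠ 0 := by exact_mod_cast hv.ne'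
  rw [Complex.ofReal_exp, ← Complex.exp_add, ← Complex.exp_add]
  congr 1
  push_cast
  field_simp
  linear_combination (τ : ℂ) ^ 2 * Complex.I_sq

/-- Integrating `exp ((z - s)² / (2v)) G z` up the two sides of the strip: on `Re z = s` the weight
is the Gaussian density, on `Re z = 0` it is that density times a character. -/
theorem integral_gaussianReal_shift (hs : 0 < s) (hG : DiffContOnCl ℂ G (Complex.re ⁻¹' Ioo 0 s))
    (hB : ∀ z : ℂ, z.re ∈ Icc 0 s → ‖G z‖ ≤ B) {v : ℝ≥0} (hv : v ≠ 0) :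
    ∫ τ, G (s + τ * Complex.I) ∂gaussianReal 0 v =
      Complex.exp (s ^ 2 / (2 * v)) *
        ∫ τ, G (τ * Complex.I) * Complex.exp (-(τ * (s / v : ℝ)) * Complex.I)
          ∂gaussianReal 0 v := by
  have hv₀ : (0 : ℝ) < v := by positivity
  have hb : 0 < 1 / (2 * (v : ℝ)) := by positivity
  have hexp : Differentiable ℂ fun z : ℂ => Complex.exp ((z - s) ^ 2 / (2 * (v : ℝ))) := by
    fun_prop
  have hdecay : Tendsto (fun τ : ℝ => Real.exp (s ^ 2 / (2 * v)) * B *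
      Real.exp (-(1 / (2 * v)) * τ ^ 2)) (cocompact ℝ) (𝓝 0) := by
    simpa only [Real.rpow_zero, one_mul, mul_zero] using
      (tendsto_rpow_abs_mul_exp_neg_mul_sq_cocompact hb 0).const_mul
        (Real.exp (s ^ 2 / (2 * v)) * B)
  have hshift := integral_verticalLine_eq hs (hexp.diffContOnCl.smul hG)
    ((integrable_exp_neg_mul_sq hb).const_mul _) hdecay
    (fun z hz => norm_cexp_sq_div_mul_le hv₀ hB hz)
  simp only [integral_gaussianReal_eq_integral_smul hv, gaussianPDFReal, mul_smul, integral_smul]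
  rw [mul_smul_comm, ← integral_const_mul]
  congr 1
  calc ∫ τ : ℝ, Real.exp (-(τ - 0) ^ 2 / (2 * v)) • G (s + τ * Complex.I)
      = ∫ τ : ℝ, Complex.exp ((s + τ * Complex.I - s) ^ 2 / (2 * (v : ℝ))) •
          G (s + τ * Complex.I) := by
        congr with τ
        rw [Complex.real_smul, Complex.ofReal_exp, smul_eq_mul]
        congr 2
        push_cast
        linear_combination (-(τ : ℂ) ^ 2 / (2 * v)) * Complex.I_sq
    _ = ∫ τ : ℝ, Complex.exp (((0 : ℝ) + τ * Complex.I - s) ^ 2 / (2 * (v : ℝ))) •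
          G ((0 : ℝ) + τ * Complex.I) := hshift.symm
    _ = ∫ τ : ℝ, Complex.exp (s ^ 2 / (2 * v)) * Real.exp (-(τ - 0) ^ 2 / (2 * v)) •
          (G (τ * Complex.I) * Complex.exp (-(τ * (s / v : ℝ)) * Complex.I)) := by
        congr with τ
        rw [Complex.ofReal_zero, zero_add, cexp_ofReal_mul_I_sub_sq_div hv₀, Complex.real_smul,
          sub_zero, smul_eq_mul]
        ring

theorem integral_charFun_mul_cexp (μ ν : Measure ℝ) [IsFiniteMeasure μ] [IsFiniteMeasure ν]
    (a : ℝ) :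
    ∫ t, charFun μ t * Complex.exp (-(t * a) * Complex.I) ∂ν = ∫ x, charFun ν (x - a) ∂μ := by
  have hint : Integrable (fun p : ℝ × ℝ => Complex.exp (p.1 * (p.2 - a) * Complex.I))
      (ν.prod μ) := by
    refine Integrable.of_bound (by fun_prop) 1 (.of_forall fun p => le_of_eq ?_)
    exact_mod_cast Complex.norm_exp_ofReal_mul_I (p.1 * (p.2 - a))
  calc ∫ t, charFun μ t * Complex.exp (-(t * a) * Complex.I) ∂ν
      = ∫ t, ∫ x, Complex.exp (t * (x - a) * Complex.I) ∂μ ∂ν := by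
        simp only [charFun_apply_real, ← integral_mul_const, ← Complex.exp_add]
        congr! 5
        ring
    _ = ∫ x, ∫ t, Complex.exp (t * (x - a) * Complex.I) ∂ν ∂μ := integral_integral_swap hint
    _ = ∫ x, charFun ν (x - a) ∂μ := by
        simp only [charFun_apply_real, Complex.ofReal_sub, mul_comm]

theorem tendsto_integral_gaussianReal_zero {E : Type*} [NormedAddCommGroup E] [NormedSpace ℝ E]
    [CompleteSpace E] {h : ℝ → E} (hh : Continuous h) {C : ℝ} (hC : ∀ t, ‖h t‖ ≤ C) :
    Tendsto (fun v : ℝ≥0 => ∫ t, h t ∂gaussianReal 0 v) (𝓝 0) (𝓝 (h 0)) := by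
  have hscale (v : ℝ≥0) :
      ∫ t, h t ∂gaussianReal 0 v = ∫ t, h (NNReal.sqrt v * t) ∂gaussianReal 0 1 := by
    rw [← integral_map (φ := fun t => (NNReal.sqrt v : ℝ) * t) (by fun_prop)
      hh.aestronglyMeasurable, gaussianReal_map_const_mul]
    congr 2
    · simp
    · ext; simp
  simp only [hscale]
  have hlim (t : ℝ) : Tendsto (fun v : ℝ≥0 => h (NNReal.sqrt v * t)) (𝓝 0) (𝓝 (h 0)) := by
    have : Continuous fun v : ℝ≥0 => h (NNReal.sqrt v * t) := by fun_prop
    simpa using this.tendsto 0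
  simpa using tendsto_integral_filter_of_dominated_convergence (μ := gaussianReal 0 1)
    (fun _ => C) (.of_forall fun v => Continuous.aestronglyMeasurable (by fun_prop))
    (.of_forall fun v => .of_forall fun t => hC (NNReal.sqrt v * t)) (integrable_const C)
    (.of_forall hlim)

theorem integrable_exp_mul_sub_sq (μ : Measure ℝ) [IsFiniteMeasure μ] {v : ℝ} (hv : 0 < v)
    (s : ℝ) : Integrable (fun x => Real.exp (s * x - v * x ^ 2 / 2)) μ := by
  refine .of_bound (by fun_prop) (Real.exp (s ^ 2 / (2 * v))) (.of_forall fun x => ?_)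
  rw [Real.norm_of_nonneg (Real.exp_nonneg _), Real.exp_le_exp, ← sub_nonneg]
  have : s ^ 2 / (2 * v) - (s * x - v * x ^ 2 / 2) = (s - v * x) ^ 2 / (2 * v) := by
    field_simp
    ring
  rw [this]
  positivity

variable {μ : Measure ℝ} [IsFiniteMeasure μ]

theorem integral_exp_mul_sub_sq_of_charFun_eq (hs : 0 < s)
    (hG : DiffContOnCl ℂ G (Complex.re ⁻¹' Ioo 0 s))
    (hB : ∀ z : ℂ, z.re ∈ Icc 0 s → ‖G z‖ ≤ B)
    (hμ : ∀ t : ℝ, charFun μ t = G (t * Complex.I)) {v : ℝ≥0} (hv : v ≠ 0) :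
    ((∫ x, Real.exp (s * x - v * x ^ 2 / 2) ∂μ : ℝ) : ℂ) =
      ∫ τ, G (s + τ * Complex.I) ∂gaussianReal 0 v := by
  have hvC : (v : ℂ) ≠ 0 := by exact_mod_cast hv
  rw [integral_gaussianReal_shift hs hG hB hv]
  simp only [← hμ]
  rw [integral_charFun_mul_cexp, ← integral_const_mul, ← integral_complex_ofReal]
  congr with x
  rw [charFun_gaussianReal, Complex.ofReal_exp, ← Complex.exp_add]
  congr 1
  push_cast
  field_simp
  ring

theorem integrable_exp_mul_of_charFun_eq (hs : 0 < s)
    (hG : DiffContOnCl ℂ G (Complex.re ⁻¹' Ioo 0 s))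
    (hB : ∀ z : ℂ, z.re ∈ Icc 0 s → ‖G z‖ ≤ B)
    (hμ : ∀ t : ℝ, charFun μ t = G (t * Complex.I)) :
    Integrable (fun x => Real.exp (s * x)) μ := by
  have hbound {v : ℝ≥0} (hv : v ≠ 0) :
      ∫⁻ x, ‖Real.exp (s * x - v * x ^ 2 / 2)‖ₑ ∂μ ≤ ENNReal.ofReal B := by
    rw [← ofReal_integral_norm_eq_lintegral_enorm (integrable_exp_mul_sub_sq μ (by positivity) s)]
    refine ENNReal.ofReal_le_ofReal ?_
    calc ∫ x, ‖Real.exp (s * x - v * x ^ 2 / 2)‖ ∂μ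
        = ‖((∫ x, Real.exp (s * x - v * x ^ 2 / 2) ∂μ : ℝ) : ℂ)‖ := by
          rw [Complex.norm_of_nonneg (by positivity)]
          simp only [Real.norm_of_nonneg (Real.exp_nonneg _)]
      _ = ‖∫ τ, G (s + τ * Complex.I) ∂gaussianReal 0 v‖ := by
          rw [integral_exp_mul_sub_sq_of_charFun_eq hs hG hB hμ hv]
      _ ≤ B := by
          simpa using norm_integral_le_of_norm_le_const (μ := gaussianReal 0 v)
            (.of_forall fun τ : ℝ => hB (s + τ * Complex.I) (by simp [hs.le]))
  let v (n : ℕ) : ℝ≥0 := ((n + 1 : ℕ) : ℝ≥0)⁻¹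
  have hv : Tendsto v atTop (𝓝 0) :=
    (tendsto_inv_atTop_nhds_zero_nat (𝕜 := ℝ≥0)).comp (tendsto_add_atTop_nat 1)
  refine integrable_of_tendsto (G := fun n x => Real.exp (s * x - v n * x ^ 2 / 2))
    (.of_forall fun x => ?_) (fun n => by fun_prop) ?_
  · have : Continuous fun w : ℝ≥0 => Real.exp (s * x - w * x ^ 2 / 2) := by fun_prop
    simpa [Function.comp_def] using (this.tendsto 0).comp hv
  · refine ne_top_of_le_ne_top (b := ENNReal.ofReal B) ENNReal.ofReal_ne_top
      (liminf_le_of_frequently_le' ?_)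
    exact .of_forall fun n => hbound (by positivity)

theorem mgf_id_eq_of_charFun_eq (hs : 0 < s)
    (hG : DiffContOnCl ℂ G (Complex.re ⁻¹' Ioo 0 s))
    (hB : ∀ z : ℂ, z.re ∈ Icc 0 s → ‖G z‖ ≤ B)
    (hμ : ∀ t : ℝ, charFun μ t = G (t * Complex.I)) :
    (mgf id μ s : ℂ) = G s := by
  have hline : Continuous fun τ : ℝ => G (s + τ * Complex.I) := by
    refine hG.continuousOn.comp_continuous (by fun_prop) fun τ => ?_
    simp [Complex.closure_preimage_re, closure_Ioo hs.ne, hs.le]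
  have hright : Tendsto (fun v : ℝ≥0 => ∫ τ, G (s + τ * Complex.I) ∂gaussianReal 0 v) (𝓝[≠] 0)
      (𝓝 (G s)) := by
    simpa using (tendsto_integral_gaussianReal_zero hline
      fun τ => hB (s + τ * Complex.I) (by simp [hs.le])).mono_left nhdsWithin_le_nhds
  have hleft : Tendsto (fun v : ℝ≥0 => ∫ x, Real.exp (s * x - v * x ^ 2 / 2) ∂μ) (𝓝[≠] 0)
      (𝓝 (mgf id μ s)) := by
    refine (tendsto_integral_filter_of_dominated_convergence (fun x => Real.exp (s * x))
      (.of_forall fun v => Continuous.aestronglyMeasurable (by fun_prop))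
      (.of_forall fun v => .of_forall fun x => ?_)
      (integrable_exp_mul_of_charFun_eq hs hG hB hμ)
      (.of_forall fun x => ?_)).mono_left nhdsWithin_le_nhds
    · rw [Real.norm_of_nonneg (Real.exp_nonneg _)]
      gcongr
      exact sub_le_self _ (by positivity)
    · have : Continuous fun v : ℝ≥0 => Real.exp (s * x - v * x ^ 2 / 2) := by fun_prop
      simpa using this.tendsto 0
  refine tendsto_nhds_unique (((Complex.continuous_ofReal.tendsto _).comp hleft).congr' ?_) hright
  filter_upwards [self_mem_nhdsWithin] with v hv
  exact integral_exp_mul_sub_sq_of_charFun_eq hs hG hB hμ hv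

end BoundedExtension

section LaplaceExponent

theorem norm_cexp_neg_sub_one_le {u : ℂ} (hu : 0 ≤ u.re) :
    ‖Complex.exp (-u) - 1‖ ≤ 2 * min 1 ‖u‖ := by
  rcases le_total ‖u‖ 1 with h | h
  · rw [min_eq_right h]
    simpa using Complex.norm_exp_sub_one_le (x := -u) (by simpa using h)
  · have hexp : ‖Complex.exp (-u)‖ ≤ 1 := by simpa [Complex.norm_exp] using hu
    rw [min_eq_left h]
    refine (norm_sub_le _ _).trans ?_
    rw [norm_one]
    linarith

theorem norm_cexp_neg_sub_one_add_le {u : ℂ} (hu : 0 ≤ u.re) :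
    ‖Complex.exp (-u) - 1 + u‖ ≤ 3 * min ‖u‖ (‖u‖ ^ 2) := by
  rcases le_total ‖u‖ 1 with h | h
  · have htaylor := Complex.norm_exp_sub_one_sub_id_le (x := -u) (by simpa using h)
    rw [sub_neg_eq_add, norm_neg] at htaylor
    rw [min_eq_right (pow_le_of_le_one (norm_nonneg u) h two_ne_zero)]
    linarith [sq_nonneg ‖u‖]
  · have hexp := norm_cexp_neg_sub_one_le hu
    rw [min_eq_left h] at hexp
    rw [min_eq_left (le_self_pow₀ h two_ne_zero)]
    linarith [norm_add_le (Complex.exp (-u) - 1) u]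

theorem min_mul_sq_le_mul_min {r R x : ℝ} (hr : 0 ≤ r) (hrR : r ≤ R) (hx : 0 ≤ x) :
    min (r * x) ((r * x) ^ 2) ≤ (R + R ^ 2) * min x (x ^ 2) := by
  have hR := hr.trans hrR
  rw [mul_min_of_nonneg _ _ (by positivity)]
  refine min_le_min ?_ ?_
  · exact mul_le_mul_of_nonneg_right (hrR.trans (le_add_of_nonneg_right (sq_nonneg R))) hx
  · rw [mul_pow]
    gcongr
    exact (pow_le_pow_left₀ hr hrR 2).trans (le_add_of_nonneg_left hR)

theorem norm_cexp_neg_mul_sub_one_add_le {z : ℂ} {R x : ℝ} (hz : 0 ≤ z.re) (hR : ‖z‖ ≤ R)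
    (hx : 0 ≤ x) :
    ‖Complex.exp (-(z * x)) - 1 + z * x‖ ≤ 3 * (R + R ^ 2) * min x (x ^ 2) := by
  have hre : 0 ≤ (z * x).re := by simpa using mul_nonneg hz hx
  refine (norm_cexp_neg_sub_one_add_le hre).trans ?_
  rw [norm_mul, Complex.norm_of_nonneg hx, mul_assoc]
  gcongr
  exact min_mul_sq_le_mul_min (norm_nonneg z) hR hx

theorem norm_mul_cexp_neg_mul_sub_one_le {z : ℂ} {R x : ℝ} (hz : 0 ≤ z.re) (hR : ‖z‖ ≤ R)
    (hx : 0 ≤ x) :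
    ‖x * (1 - Complex.exp (-(z * x)))‖ ≤ 2 * (1 + R) * min x (x ^ 2) := by
  have hR₀ := (norm_nonneg z).trans hR
  have hexp := norm_cexp_neg_sub_one_le (u := z * x) (by simpa using mul_nonneg hz hx)
  rw [norm_mul, Complex.norm_of_nonneg hx] at hexp
  rw [norm_mul, Complex.norm_of_nonneg hx, norm_sub_rev]
  calc x * ‖Complex.exp (-(z * x)) - 1‖ ≤ x * (2 * min 1 (‖z‖ * x)) := by gcongr
    _ = 2 * min x (‖z‖ * x ^ 2) := by
      rw [mul_left_comm, mul_min_of_nonneg _ _ hx]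
      ring_nf
    _ ≤ 2 * min ((1 + R) * x) ((1 + R) * x ^ 2) := by
      gcongr
      · exact le_mul_of_one_le_left hx (by linarith)
      · linarith
    _ = 2 * (1 + R) * min x (x ^ 2) := by rw [← mul_min_of_nonneg _ _ (by positivity), mul_assoc]

theorem one_sub_exp_neg_sq (s x : ℝ) :
    (1 - Real.exp (-(s * x))) ^ 2 =
      (Real.exp (-(2 * s * x)) - 1 + 2 * s * x) - 2 * (Real.exp (-(s * x)) - 1 + s * x) := by
  rw [show -(2 * s * x) = -(s * x) + -(s * x) by ring, Real.exp_add]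
  ring

/-- A Lévy measure carried by the positive half-line, with finite mean jump size away from zero,
so that all jumps can be compensated. -/
structure IsSpectrallyPositiveLevyMeasure (ν : Measure ℝ) : Prop where
  ae_pos : ∀ᵐ x ∂ν, 0 < x
  integrable_min : Integrable (fun x => min x (x ^ 2)) ν

/-- The Laplace exponent `ψ(z) = ∫ (e^{-zx} - 1 + zx) dν(x)` of the fully compensated infinitely
divisible law with Lévy measure `ν`, so that `E exp(-zX) = exp (ψ z)`. -/
noncomputable def laplaceExponent (ν : Measure ℝ) (z : ℂ) : ℂ :=
  ∫ x, (Complex.exp (-(z * x)) - 1 + z * x) ∂ν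

/-- The real-valued Laplace exponent `ψ(s) = ∫ (e^{-sx} - 1 + sx) dν(x)`, kept apart from
`laplaceExponent` so that bounds on `ψ` are inequalities between real integrals. -/
noncomputable def realLaplaceExponent (ν : Measure ℝ) (s : ℝ) : ℝ :=
  ∫ x, (Real.exp (-(s * x)) - 1 + s * x) ∂ν

theorem laplaceExponent_ofReal (ν : Measure ℝ) (s : ℝ) :
    laplaceExponent ν s = realLaplaceExponent ν s := by
  rw [laplaceExponent, realLaplaceExponent, ← integral_complex_ofReal]
  push_cast
  rfl

namespace IsSpectrallyPositiveLevyMeasure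

variable {ν : Measure ℝ} (hν : IsSpectrallyPositiveLevyMeasure ν)
include hν

theorem integrable_laplaceExponent_integrand {z : ℂ} (hz : 0 ≤ z.re) :
    Integrable (fun x : ℝ => Complex.exp (-(z * x)) - 1 + z * x) ν := by
  refine (hν.integrable_min.const_mul (3 * (‖z‖ + ‖z‖ ^ 2))).mono' (by fun_prop) ?_
  filter_upwards [hν.ae_pos] with x hx
  exact norm_cexp_neg_mul_sub_one_add_le hz le_rfl hx.le

theorem integrable_realLaplaceExponent_integrand {s : ℝ} (hs : 0 ≤ s) :
    Integrable (fun x => Real.exp (-(s * x)) - 1 + s * x) ν := by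
  have h := (hν.integrable_laplaceExponent_integrand (z := s) (by simpa using hs)).re
  refine h.congr (.of_forall fun x => ?_)
  simp only [RCLike.re_to_complex]
  exact_mod_cast Complex.ofReal_re (Real.exp (-(s * x)) - 1 + s * x)

theorem continuousOn_laplaceExponent : ContinuousOn (laplaceExponent ν) {z | 0 ≤ z.re} := by
  intro z₀ _
  have hball : ∀ᶠ z in 𝓝[{z : ℂ | 0 ≤ z.re}] z₀, z ∈ {z : ℂ | 0 ≤ z.re} ∩ Metric.ball z₀ 1 :=
    inter_mem self_mem_nhdsWithin
      (mem_nhdsWithin_of_mem_nhds (Metric.ball_mem_nhds z₀ one_pos))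
  refine continuousWithinAt_of_dominated
    (bound := fun x => 3 * ((‖z₀‖ + 1) + (‖z₀‖ + 1) ^ 2) * min x (x ^ 2))
    (.of_forall fun z => by fun_prop) ?_ (hν.integrable_min.const_mul _)
    (.of_forall fun x => by fun_prop)
  filter_upwards [hball] with z hz
  filter_upwards [hν.ae_pos] with x hx
  exact norm_cexp_neg_mul_sub_one_add_le hz.1 (norm_lt_of_mem_ball hz.2).le hx.le

theorem differentiableOn_laplaceExponent :
    DifferentiableOn ℂ (laplaceExponent ν) {z | 0 < z.re} := by
  intro z₀ hz₀
  have hU : {z : ℂ | 0 < z.re} ∩ Metric.ball z₀ 1 ∈ 𝓝 z₀ :=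
    inter_mem ((isOpen_lt continuous_const Complex.continuous_re).mem_nhds hz₀)
      (Metric.ball_mem_nhds z₀ one_pos)
  refine (hasDerivAt_integral_of_dominated_loc_of_deriv_le
    (F := fun (z : ℂ) (x : ℝ) => Complex.exp (-(z * x)) - 1 + z * x)
    (F' := fun (z : ℂ) (x : ℝ) => x * (1 - Complex.exp (-(z * x))))
    (bound := fun x => 2 * (1 + (‖z₀‖ + 1)) * min x (x ^ 2)) hU
    (.of_forall fun z => by fun_prop) (hν.integrable_laplaceExponent_integrand (le_of_lt hz₀))
    (by fun_prop) ?_ (hν.integrable_min.const_mul _)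
    (.of_forall fun x z _ => ?_)).2.differentiableAt.differentiableWithinAt
  · filter_upwards [hν.ae_pos] with x hx z hz
    exact norm_mul_cexp_neg_mul_sub_one_le (le_of_lt hz.1) (norm_lt_of_mem_ball hz.2).le hx.le
  · have hlin : HasDerivAt (fun z : ℂ => z * (x : ℂ)) x z := by
      simpa using (hasDerivAt_id z).mul_const (x : ℂ)
    exact ((hlin.neg.cexp.sub_const 1).add hlin).congr_deriv (by simp only [Pi.neg_apply]; ring)

theorem diffContOnCl_laplaceExponent :
    DiffContOnCl ℂ (laplaceExponent ν) (Complex.re ⁻¹' Ioi 0) where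
  differentiableOn := hν.differentiableOn_laplaceExponent
  continuousOn := by
    rw [Complex.closure_preimage_re, closure_Ioi]
    exact hν.continuousOn_laplaceExponent

theorem re_laplaceExponent_le {z : ℂ} (hz : 0 ≤ z.re) :
    (laplaceExponent ν z).re ≤ realLaplaceExponent ν z.re := by
  have hint := hν.integrable_laplaceExponent_integrand hz
  rw [laplaceExponent, ← RCLike.re_to_complex, ← integral_re hint]
  refine integral_mono hint.re (hν.integrable_realLaplaceExponent_integrand hz) fun x => ?_
  have hexp := Complex.re_le_norm (Complex.exp (-(z * x)))
  rw [Complex.norm_exp] at hexp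
  simpa using hexp

theorem realLaplaceExponent_le_of_le {s t : ℝ} (hs : 0 ≤ s) (hst : s ≤ t) :
    realLaplaceExponent ν s ≤ realLaplaceExponent ν t := by
  refine integral_mono_ae (hν.integrable_realLaplaceExponent_integrand hs)
    (hν.integrable_realLaplaceExponent_integrand (hs.trans hst)) ?_
  filter_upwards [hν.ae_pos] with x hx
  have hsx : Real.exp (-(s * x)) ≤ 1 := Real.exp_le_one_iff.mpr (by nlinarith)
  have hgap : 0 ≤ (t - s) * x := mul_nonneg (sub_nonneg.mpr hst) hx.le
  have hsplit : Real.exp (-(t * x)) = Real.exp (-(s * x)) * Real.exp (-((t - s) * x)) := by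
    rw [← Real.exp_add]
    ring_nf
  rw [hsplit]
  nlinarith [Real.add_one_le_exp (-((t - s) * x)), Real.exp_pos (-(s * x))]

theorem integrable_one_sub_exp_neg_sq {s : ℝ} (hs : 0 ≤ s) :
    Integrable (fun x => (1 - Real.exp (-(s * x))) ^ 2) ν := by
  simp only [one_sub_exp_neg_sq]
  exact (hν.integrable_realLaplaceExponent_integrand (mul_nonneg zero_le_two hs)).sub
    ((hν.integrable_realLaplaceExponent_integrand hs).const_mul 2)

theorem realLaplaceExponent_two_mul_sub {s : ℝ} (hs : 0 ≤ s) :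
    realLaplaceExponent ν (2 * s) - 2 * realLaplaceExponent ν s =
      ∫ x, (1 - Real.exp (-(s * x))) ^ 2 ∂ν := by
  simp only [one_sub_exp_neg_sq]
  rw [integral_sub (hν.integrable_realLaplaceExponent_integrand (mul_nonneg zero_le_two hs))
    ((hν.integrable_realLaplaceExponent_integrand hs).const_mul 2), integral_const_mul,
    realLaplaceExponent, realLaplaceExponent]

section CharFun

variable {μ : Measure ℝ} [IsFiniteMeasure μ]
  (hμ : ∀ t : ℝ, charFun μ t = Complex.exp (laplaceExponent ν (t * Complex.I))) {s : ℝ}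

theorem diffContOnCl_cexp_laplaceExponent :
    DiffContOnCl ℂ (fun z => Complex.exp (laplaceExponent ν z)) (Complex.re ⁻¹' Ioo 0 s) :=
  Complex.differentiable_exp.comp_diffContOnCl
    (hν.diffContOnCl_laplaceExponent.mono (preimage_mono Ioo_subset_Ioi_self))

theorem norm_cexp_laplaceExponent_le {z : ℂ} (hz : z.re ∈ Icc 0 s) :
    ‖Complex.exp (laplaceExponent ν z)‖ ≤ Real.exp (realLaplaceExponent ν s) := by
  rw [Complex.norm_exp, Real.exp_le_exp]
  exact (hν.re_laplaceExponent_le hz.1).trans (hν.realLaplaceExponent_le_of_le hz.1 hz.2)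

include hμ

theorem integrable_exp_mul (hs : 0 < s) : Integrable (fun x => Real.exp (s * x)) μ :=
  integrable_exp_mul_of_charFun_eq hs hν.diffContOnCl_cexp_laplaceExponent
    (fun _ => hν.norm_cexp_laplaceExponent_le) hμ

theorem cgf_id_eq (hs : 0 < s) : cgf id μ s = realLaplaceExponent ν s := by
  have h := mgf_id_eq_of_charFun_eq hs hν.diffContOnCl_cexp_laplaceExponent
    (fun _ => hν.norm_cexp_laplaceExponent_le) hμ
  rw [laplaceExponent_ofReal, ← Complex.ofReal_exp, Complex.ofReal_inj] at h
  rw [cgf, h, Real.log_exp]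

end CharFun

end IsSpectrallyPositiveLevyMeasure

end LaplaceExponent

section StableLevyMeasure

/-- The Lévy measure `x^{-α-1} dx` on `(0, ∞)` of the totally asymmetric `α`-stable law. -/
noncomputable def stableLevyMeasure (α : ℝ) : Measure ℝ :=
  (volume.restrict (Ioi 0)).withDensity fun x => ENNReal.ofReal (x ^ (-(α + 1)))

variable {E : Type*} [NormedAddCommGroup E] [NormedSpace ℝ E] {α : ℝ}

theorem ae_pos_stableLevyMeasure (α : ℝ) : ∀ᵐ x ∂stableLevyMeasure α, 0 < x :=
  (withDensity_absolutelyContinuous _ _).ae_le (ae_restrict_mem measurableSet_Ioi)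

theorem setIntegral_stableLevyMeasure {S : Set ℝ} (hS : MeasurableSet S) (f : ℝ → E) :
    ∫ x in S, f x ∂stableLevyMeasure α = ∫ x in S ∩ Ioi 0, x ^ (-(α + 1)) • f x := by
  rw [stableLevyMeasure, setIntegral_withDensity_eq_setIntegral_toReal_smul (by fun_prop)
    (.of_forall fun _ => ENNReal.ofReal_lt_top) _ hS, Measure.restrict_restrict hS]
  refine setIntegral_congr_fun (hS.inter measurableSet_Ioi) fun x hx => ?_
  simp only [ENNReal.toReal_ofReal (Real.rpow_nonneg (le_of_lt hx.2) _)]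

theorem integrableOn_stableLevyMeasure {S : Set ℝ} (hS : MeasurableSet S) {f : ℝ → E} :
    IntegrableOn f S (stableLevyMeasure α) ↔
      IntegrableOn (fun x => x ^ (-(α + 1)) • f x) (S ∩ Ioi 0) := by
  rw [IntegrableOn, stableLevyMeasure, restrict_withDensity hS, Measure.restrict_restrict hS,
    integrable_withDensity_iff_integrable_smul' (by fun_prop)
      (.of_forall fun _ => ENNReal.ofReal_lt_top)]
  refine integrableOn_congr_fun (fun x hx => ?_) (hS.inter measurableSet_Ioi)
  simp only [ENNReal.toReal_ofReal (Real.rpow_nonneg (le_of_lt hx.2) _)]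

theorem stableExponent_eq_laplaceExponent (α t : ℝ) :
    stableExponent α t = laplaceExponent (stableLevyMeasure α) (-(t * Complex.I)) := by
  rw [laplaceExponent, ← setIntegral_univ, setIntegral_stableLevyMeasure .univ, univ_inter,
    stableExponent]
  refine setIntegral_congr_fun measurableSet_Ioi fun x hx => ?_
  simp only [Real.rpow_neg (le_of_lt hx), Complex.real_smul, Complex.ofReal_inv]
  rw [div_eq_inv_mul, show -(-(t * Complex.I) * x) = Complex.I * t * x by ring]
  ring

theorem rpow_neg_add_one_smul_pow {x : ℝ} (hx : 0 < x) (α : ℝ) (n : ℕ) :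
    x ^ (-(α + 1)) • x ^ n = x ^ (n - α - 1) := by
  rw [smul_eq_mul, ← Real.rpow_natCast, ← Real.rpow_add hx]
  ring_nf

theorem integrableOn_Iic_one_pow_stableLevyMeasure {n : ℕ} (hn : α < n) :
    IntegrableOn (fun x => x ^ n) (Iic 1) (stableLevyMeasure α) := by
  rw [integrableOn_stableLevyMeasure measurableSet_Iic, Iic_inter_Ioi]
  refine IntegrableOn.congr_fun ?_ (fun x hx => (rpow_neg_add_one_smul_pow hx.1 α n).symm)
    measurableSet_Ioc
  exact (intervalIntegrable_iff_integrableOn_Ioc_of_le zero_le_one).mp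
    (intervalIntegral.intervalIntegrable_rpow' (r := n - α - 1) (by linarith))

theorem setIntegral_Iic_one_pow_stableLevyMeasure {n : ℕ} (hn : α < n) :
    ∫ x in Iic 1, x ^ n ∂stableLevyMeasure α = 1 / (n - α) := by
  rw [setIntegral_stableLevyMeasure measurableSet_Iic, Iic_inter_Ioi,
    setIntegral_congr_fun measurableSet_Ioc fun x hx => rpow_neg_add_one_smul_pow hx.1 α n,
    ← intervalIntegral.integral_of_le zero_le_one, integral_rpow (Or.inl (by linarith)),
    sub_add_cancel, Real.one_rpow, Real.zero_rpow (by linarith), sub_zero]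

theorem integrableOn_Ioi_one_pow_stableLevyMeasure {n : ℕ} (hn : n < α) :
    IntegrableOn (fun x => x ^ n) (Ioi 1) (stableLevyMeasure α) := by
  rw [integrableOn_stableLevyMeasure measurableSet_Ioi,
    inter_eq_left.mpr (Ioi_subset_Ioi zero_le_one)]
  exact (integrableOn_Ioi_rpow_of_lt (a := n - α - 1) (by linarith) one_pos).congr_fun
    (fun x hx => (rpow_neg_add_one_smul_pow (one_pos.trans hx) α n).symm) measurableSet_Ioi

theorem setIntegral_Ioi_one_pow_stableLevyMeasure {n : ℕ} (hn : n < α) :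
    ∫ x in Ioi 1, x ^ n ∂stableLevyMeasure α = 1 / (α - n) := by
  rw [setIntegral_stableLevyMeasure measurableSet_Ioi,
    inter_eq_left.mpr (Ioi_subset_Ioi zero_le_one),
    setIntegral_congr_fun measurableSet_Ioi
      fun x hx => rpow_neg_add_one_smul_pow (one_pos.trans hx) α n,
    integral_Ioi_rpow_of_lt (by linarith) one_pos, Real.one_rpow, sub_add_cancel,
    neg_div, ← div_neg, neg_sub]

theorem isSpectrallyPositiveLevyMeasure_stableLevyMeasure (hα : α ∈ Ioo 1 2) :
    IsSpectrallyPositiveLevyMeasure (stableLevyMeasure α) where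
  ae_pos := ae_pos_stableLevyMeasure α
  integrable_min := by
    rw [← integrableOn_univ, ← Iic_union_Ioi (a := (1 : ℝ)), integrableOn_union]
    constructor
    · refine (integrableOn_Iic_one_pow_stableLevyMeasure (n := 2) (by exact_mod_cast hα.2)).mono'
        (by fun_prop) ?_
      filter_upwards [ae_restrict_of_ae (ae_pos_stableLevyMeasure α)] with x hx
      rw [Real.norm_of_nonneg (by positivity)]
      exact min_le_right _ _
    · refine (integrableOn_Ioi_one_pow_stableLevyMeasure (n := 1) (by exact_mod_cast hα.1)).mono'
        (by fun_prop) ?_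
      filter_upwards [ae_restrict_of_ae (ae_pos_stableLevyMeasure α)] with x hx
      rw [Real.norm_of_nonneg (by positivity), pow_one]
      exact min_le_left _ _

theorem integral_stableLevyMeasure_le (hα : α ∈ Ioo 1 2) {g : ℝ → ℝ} {a b c d : ℝ}
    (hg : Integrable g (stableLevyMeasure α))
    (hsmall : ∀ x ∈ Ioc (0 : ℝ) 1, g x ≤ a * x ^ 2 + b * x ^ 3)
    (hlarge : ∀ x ∈ Ioi (1 : ℝ), g x ≤ c * x + d) :
    ∫ x, g x ∂stableLevyMeasure α ≤ a / (2 - α) + b / (3 - α) + c / (α - 1) + d / α := by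
  have h₂ : α < (2 : ℕ) := by exact_mod_cast hα.2
  have h₃ : α < (3 : ℕ) := by push_cast; linarith [hα.2]
  have h₁ : (1 : ℕ) < α := by exact_mod_cast hα.1
  have h₀ : (0 : ℕ) < α := by push_cast; linarith [hα.1]
  have i₂ := (integrableOn_Iic_one_pow_stableLevyMeasure h₂).const_mul a
  have i₃ := (integrableOn_Iic_one_pow_stableLevyMeasure h₃).const_mul b
  have i₁ := (integrableOn_Ioi_one_pow_stableLevyMeasure h₁).const_mul c
  have i₀ := (integrableOn_Ioi_one_pow_stableLevyMeasure h₀).const_mul d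
  have hIic : ∫ x in Iic 1, g x ∂stableLevyMeasure α ≤ a / (2 - α) + b / (3 - α) := by
    calc _ ≤ ∫ x in Iic 1, (a * x ^ 2 + b * x ^ 3) ∂stableLevyMeasure α := by
          refine setIntegral_mono_on_ae hg.integrableOn (i₂.add i₃) measurableSet_Iic ?_
          filter_upwards [ae_pos_stableLevyMeasure α] with x hx hx1
          exact hsmall x ⟨hx, hx1⟩
      _ = _ := by
          rw [integral_add i₂ i₃, integral_const_mul, integral_const_mul,
            setIntegral_Iic_one_pow_stableLevyMeasure h₂,
            setIntegral_Iic_one_pow_stableLevyMeasure h₃, mul_one_div, mul_one_div]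
          norm_cast
  have hIoi : ∫ x in Ioi 1, g x ∂stableLevyMeasure α ≤ c / (α - 1) + d / α := by
    calc _ ≤ ∫ x in Ioi 1, (c * x ^ 1 + d * x ^ 0) ∂stableLevyMeasure α := by
          refine setIntegral_mono_on hg.integrableOn (i₁.add i₀) measurableSet_Ioi fun x hx => ?_
          simpa using hlarge x hx
      _ = _ := by
          rw [integral_add i₁ i₀, integral_const_mul, integral_const_mul,
            setIntegral_Ioi_one_pow_stableLevyMeasure h₁,
            setIntegral_Ioi_one_pow_stableLevyMeasure h₀, mul_one_div, mul_one_div,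
            Nat.cast_one, Nat.cast_zero, sub_zero]
  rw [← integral_add_compl measurableSet_Iic hg, compl_Iic]
  exact (add_le_add hIic hIoi).trans_eq (add_assoc _ _ _).symm

theorem realLaplaceExponent_stableLevyMeasure_eq_mul_rpow (α : ℝ) {s : ℝ} (hs : 0 < s) :
    realLaplaceExponent (stableLevyMeasure α) s =
      realLaplaceExponent (stableLevyMeasure α) 1 * s ^ α := by
  have hψ (t : ℝ) : realLaplaceExponent (stableLevyMeasure α) t =
      ∫ x in Ioi 0, x ^ (-(α + 1)) • (Real.exp (-(t * x)) - 1 + t * x) := by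
    rw [realLaplaceExponent, ← setIntegral_univ, setIntegral_stableLevyMeasure .univ, univ_inter]
  have hcomp := integral_comp_mul_left_Ioi
    (fun x : ℝ => x ^ (-(α + 1)) • (Real.exp (-(1 * x)) - 1 + 1 * x)) 0 hs
  rw [mul_zero, ← hψ, smul_eq_mul] at hcomp
  rw [hψ, mul_comm, ← mul_inv_cancel_left₀ hs.ne' (realLaplaceExponent _ 1), ← hcomp, ← mul_assoc,
    ← Real.rpow_add_one hs.ne', ← integral_const_mul]
  refine setIntegral_congr_fun measurableSet_Ioi fun x hx => ?_
  simp only [one_mul, smul_eq_mul]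
  rw [Real.mul_rpow hs.le (le_of_lt hx), ← mul_assoc, ← mul_assoc, ← Real.rpow_add hs,
    add_neg_cancel, Real.rpow_zero, one_mul]

end StableLevyMeasure

section TailBounds

variable {Ω : Type*} [MeasurableSpace Ω] {P : Measure Ω}

theorem sq_integral_le_measureReal_univ_mul [IsFiniteMeasure P] {Y : Ω → ℝ} (hY : MemLp Y 2 P) :
    (∫ ω, Y ω ∂P) ^ 2 ≤ P.real univ * ∫ ω, Y ω ^ 2 ∂P := by
  have hint : Integrable Y P := hY.integrable one_le_two
  have hint_sq : Integrable (fun ω => Y ω ^ 2) P := hY.integrable_sq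
  have hquad (t : ℝ) :
      0 ≤ (∫ ω, Y ω ^ 2 ∂P) * (t * t) + 2 * (∫ ω, Y ω ∂P) * t + P.real univ := by
    calc 0 ≤ ∫ ω, (Y ω * t + 1) ^ 2 ∂P := integral_nonneg fun ω => sq_nonneg _
      _ = ∫ ω, (Y ω ^ 2 * (t * t) + Y ω * (2 * t) + 1) ∂P :=
        integral_congr_ae (.of_forall fun ω => by ring)
      _ = _ := by
        rw [integral_add (by fun_prop) (integrable_const _), integral_add (by fun_prop)
          (by fun_prop), integral_mul_const, integral_mul_const, integral_const, smul_eq_mul]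
        ring
  have hdiscrim := discrim_le_zero hquad
  rw [discrim] at hdiscrim
  linarith

theorem paley_zygmund [IsProbabilityMeasure P] {Y : Ω → ℝ} (hY : MemLp Y 2 P) {θ : ℝ}
    (hθ₀ : 0 ≤ θ) (hθ : θ ≤ ∫ ω, Y ω ∂P) :
    (∫ ω, Y ω ∂P - θ) ^ 2 ≤ (∫ ω, Y ω ^ 2 ∂P) * P.real {ω | θ ≤ Y ω} := by
  set A := {ω | θ ≤ Y ω}
  have hint : Integrable Y P := hY.integrable one_le_two
  have hAmeas : NullMeasurableSet A P := nullMeasurableSet_le aemeasurable_const hint.aemeasurable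
  have hAcompl : ∫ ω in Aᶜ, Y ω ∂P ≤ θ := by
    calc ∫ ω in Aᶜ, Y ω ∂P ≤ ∫ _ in Aᶜ, θ ∂P :=
          setIntegral_mono_on₀ hint.integrableOn (integrable_const θ) hAmeas.compl
            fun ω (hω : ¬θ ≤ Y ω) => (not_le.mp hω).le
      _ = P.real Aᶜ * θ := by rw [setIntegral_const, smul_eq_mul]
      _ ≤ θ := mul_le_of_le_one_left hθ₀ measureReal_le_one
  have hsplit : ∫ ω, Y ω ∂P - θ ≤ ∫ ω in A, Y ω ∂P := by
    rw [← integral_add_compl₀ hAmeas hint]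
    linarith
  calc (∫ ω, Y ω ∂P - θ) ^ 2 ≤ (∫ ω in A, Y ω ∂P) ^ 2 :=
        pow_le_pow_left₀ (sub_nonneg.mpr hθ) hsplit 2
    _ ≤ P.real A * ∫ ω in A, Y ω ^ 2 ∂P := by
        simpa using sq_integral_le_measureReal_univ_mul (hY.restrict A)
    _ ≤ P.real A * ∫ ω, Y ω ^ 2 ∂P := by
        gcongr ?_ * ?_
        exact setIntegral_le_integral hY.integrable_sq (.of_forall fun ω => sq_nonneg _)
    _ = _ := mul_comm _ _

theorem le_measureReal_ge_of_add_le_cgf [IsProbabilityMeasure P] {Y : Ω → ℝ} {t w c : ℝ}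
    (ht : 0 < t) (hint : Integrable (fun ω => Real.exp (2 * t * Y ω)) P) (hc : 0 ≤ c)
    (hw : t * w + c ≤ cgf Y P t) :
    (1 - Real.exp (-c)) ^ 2 * Real.exp (-(cgf Y P (2 * t) - 2 * cgf Y P t)) ≤
      P.real {ω | w ≤ Y ω} := by
  have hint₁ : Integrable (fun ω => Real.exp (t * Y ω)) P :=
    integrable_exp_mul_of_nonneg_of_le hint ht.le (by linarith)
  have hsq (ω : Ω) : Real.exp (t * Y ω) ^ 2 = Real.exp (2 * t * Y ω) := by
    rw [← Real.exp_nat_mul, Nat.cast_ofNat, mul_assoc]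
  have hL2 : MemLp (fun ω => Real.exp (t * Y ω)) 2 P :=
    (memLp_two_iff_integrable_sq hint₁.aestronglyMeasurable).mpr (by simpa only [hsq] using hint)
  have hthreshold : Real.exp (t * w) ≤ Real.exp (-c) * Real.exp (cgf Y P t) := by
    rw [← Real.exp_add, Real.exp_le_exp]
    linarith
  have hc_le_one : Real.exp (-c) ≤ 1 := Real.exp_le_one_iff.mpr (neg_nonpos.mpr hc)
  have hPZ := paley_zygmund hL2 (Real.exp_pos (t * w)).le <| by
    rw [← mgf, ← exp_cgf hint₁]
    exact hthreshold.trans (mul_le_of_le_one_left (Real.exp_pos _).le hc_le_one)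
  simp only [hsq, Real.exp_le_exp, mul_le_mul_iff_right₀ ht] at hPZ
  rw [← mgf, ← mgf, ← exp_cgf hint₁, ← exp_cgf hint] at hPZ
  rw [neg_sub, Real.exp_sub, mul_div_assoc', div_le_iff₀ (Real.exp_pos _),
    mul_comm (P.real _)]
  calc (1 - Real.exp (-c)) ^ 2 * Real.exp (2 * cgf Y P t)
      = ((1 - Real.exp (-c)) * Real.exp (cgf Y P t)) ^ 2 := by
        rw [mul_pow, ← Real.exp_nat_mul, Nat.cast_ofNat]
    _ ≤ (Real.exp (cgf Y P t) - Real.exp (t * w)) ^ 2 :=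
        pow_le_pow_left₀ (mul_nonneg (sub_nonneg.mpr hc_le_one) (Real.exp_pos _).le)
          (by linarith) 2
    _ ≤ _ := hPZ

end TailBounds

namespace IsTotallyAsymmetricStable

variable {Ω : Type*} [MeasurableSpace Ω] {P : Measure Ω} {α : ℝ} {X : Ω → ℝ} {s : ℝ}
  (hX : IsTotallyAsymmetricStable α X P)
include hX

theorem charFun_map_neg_eq (t : ℝ) :
    charFun (P.map (-X)) t =
      Complex.exp (laplaceExponent (stableLevyMeasure α) (t * Complex.I)) := by
  have hneg : -X = fun ω => (-1) * X ω := by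
    ext ω
    rw [Pi.neg_apply, neg_one_mul]
  rw [hneg, charFun_map_mul_comp hX.aemeasurable, hX.charFun_eq, stableExponent_eq_laplaceExponent,
    neg_one_mul, Complex.ofReal_neg, neg_mul, neg_neg]

theorem integrable_exp_mul_neg [IsFiniteMeasure P] (hα : α ∈ Ioo 1 2) (hs : 0 < s) :
    Integrable (fun ω => Real.exp (s * (-X) ω)) P :=
  ((isSpectrallyPositiveLevyMeasure_stableLevyMeasure hα).integrable_exp_mul
    hX.charFun_map_neg_eq hs).comp_aemeasurable hX.aemeasurable.neg

theorem cgf_neg_eq [IsFiniteMeasure P] (hα : α ∈ Ioo 1 2) (hs : 0 < s) :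
    cgf (-X) P s = realLaplaceExponent (stableLevyMeasure α) s := by
  rw [← (isSpectrallyPositiveLevyMeasure_stableLevyMeasure hα).cgf_id_eq hX.charFun_map_neg_eq hs,
    cgf, cgf, mgf_id_map hX.aemeasurable.neg]

theorem measureReal_le_neg_le [IsFiniteMeasure P] (hα : α ∈ Ioo 1 2) (hs : 0 < s) (w : ℝ) :
    P.real {ω | X ω ≤ -w} ≤
      Real.exp (realLaplaceExponent (stableLevyMeasure α) s - s * w) := by
  have h := measure_ge_le_exp_cgf w hs.le (hX.integrable_exp_mul_neg hα hs)
  simp only [Pi.neg_apply, le_neg (a := w)] at h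
  rwa [hX.cgf_neg_eq hα hs, neg_mul, neg_add_eq_sub] at h

theorem le_measureReal_le_neg [IsProbabilityMeasure P] (hα : α ∈ Ioo 1 2) (hs : 0 < s)
    {w c : ℝ} (hc : 0 ≤ c) (hw : s * w + c ≤ realLaplaceExponent (stableLevyMeasure α) s) :
    (1 - Real.exp (-c)) ^ 2 *
        Real.exp (-(realLaplaceExponent (stableLevyMeasure α) (2 * s) -
          2 * realLaplaceExponent (stableLevyMeasure α) s)) ≤
      P.real {ω | X ω ≤ -w} := by
  have h2s := mul_pos two_pos hs
  rw [← hX.cgf_neg_eq hα hs] at hw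
  have h := le_measureReal_ge_of_add_le_cgf hs (hX.integrable_exp_mul_neg hα h2s) hc hw
  simp only [Pi.neg_apply, le_neg (a := w)] at h
  rwa [hX.cgf_neg_eq hα hs, hX.cgf_neg_eq hα h2s] at h

end IsTotallyAsymmetricStable

section ExponentBounds

theorem exp_neg_le_one_sub_add_sq {u : ℝ} (hu : 0 ≤ u) :
    Real.exp (-u) ≤ 1 - u + u ^ 2 / 2 := by
  have hpos : 0 < 1 - u + u ^ 2 / 2 := by nlinarith [sq_nonneg (u - 1)]
  rw [Real.exp_neg, inv_le_iff_one_le_mul₀ (Real.exp_pos u)]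
  calc 1 ≤ (1 - u + u ^ 2 / 2) * (1 + u + u ^ 2 / 2) := by nlinarith [sq_nonneg (u ^ 2)]
    _ ≤ (1 - u + u ^ 2 / 2) * Real.exp u := by
        gcongr
        exact Real.quadratic_le_exp_of_nonneg hu

theorem one_sub_add_sq_sub_cube_le_exp_neg {u : ℝ} (hu : 0 ≤ u) :
    1 - u + u ^ 2 / 2 - u ^ 3 / 6 ≤ Real.exp (-u) := by
  have hder (x : ℝ) : HasDerivAt (fun x : ℝ => Real.exp (-x) - (1 - x + x ^ 2 / 2 - x ^ 3 / 6))
      (1 - x + x ^ 2 / 2 - Real.exp (-x)) x := by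
    have hpoly := (((hasDerivAt_id x).const_sub 1).add ((hasDerivAt_pow 2 x).div_const 2)).sub
      ((hasDerivAt_pow 3 x).div_const 6)
    refine ((hasDerivAt_id x).neg.exp.sub hpoly).congr_deriv ?_
    simp only [Pi.neg_apply, id_eq, Nat.cast_ofNat, Nat.add_one_sub_one, pow_one]
    ring
  have hmono : MonotoneOn (fun x : ℝ => Real.exp (-x) - (1 - x + x ^ 2 / 2 - x ^ 3 / 6))
      (Ici 0) := by
    refine monotoneOn_of_deriv_nonneg (convex_Ici 0) (by fun_prop)
      (fun x _ => (hder x).differentiableAt.differentiableWithinAt) fun x hx => ?_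
    rw [interior_Ici] at hx
    rw [(hder x).deriv, sub_nonneg]
    exact exp_neg_le_one_sub_add_sq (le_of_lt hx)
  rw [← sub_nonneg]
  simpa using hmono self_mem_Ici hu hu

variable {α s : ℝ} (hα : α ∈ Ioo 1 2)
include hα

theorem realLaplaceExponent_stableLevyMeasure_le (hs : 0 ≤ s) :
    realLaplaceExponent (stableLevyMeasure α) s ≤
      s ^ 2 / 2 / (2 - α) + s / (α - 1) + (Real.exp (-s) - 1) / α := by
  refine (integral_stableLevyMeasure_le (a := s ^ 2 / 2) (b := 0) (c := s)
    (d := Real.exp (-s) - 1) hα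
    ((isSpectrallyPositiveLevyMeasure_stableLevyMeasure
      hα).integrable_realLaplaceExponent_integrand hs)
    (fun x hx => ?_) (fun x hx => ?_)).trans_eq (by rw [zero_div, add_zero])
  · linarith [exp_neg_le_one_sub_add_sq (mul_nonneg hs hx.1.le)]
  · have hexp : Real.exp (-(s * x)) ≤ Real.exp (-s) :=
      Real.exp_le_exp.mpr (neg_le_neg (le_mul_of_one_le_right hs (le_of_lt hx)))
    linarith

theorem le_realLaplaceExponent_stableLevyMeasure (hs : 0 ≤ s) :
    s ^ 2 / 2 / (2 - α) - s ^ 3 / 6 / (3 - α) + s / (α - 1) - 1 / α ≤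
      realLaplaceExponent (stableLevyMeasure α) s := by
  have h := integral_stableLevyMeasure_le (a := -(s ^ 2 / 2)) (b := s ^ 3 / 6) (c := -s) (d := 1) hα
    ((isSpectrallyPositiveLevyMeasure_stableLevyMeasure
      hα).integrable_realLaplaceExponent_integrand hs).neg
    (fun x hx => ?_) (fun x _ => ?_)
  · simp only [Pi.neg_apply, integral_neg, neg_div] at h
    rw [realLaplaceExponent]
    linarith
  · rw [Pi.neg_apply]
    linarith [one_sub_add_sq_sub_cube_le_exp_neg (mul_nonneg hs hx.1.le)]
  · rw [Pi.neg_apply]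
    linarith [Real.exp_pos (-(s * x))]

theorem realLaplaceExponent_stableLevyMeasure_two_mul_sub_le (hs : 0 ≤ s) :
    realLaplaceExponent (stableLevyMeasure α) (2 * s) -
      2 * realLaplaceExponent (stableLevyMeasure α) s ≤ s ^ 2 / (2 - α) + 1 / α := by
  have hν := isSpectrallyPositiveLevyMeasure_stableLevyMeasure hα
  rw [hν.realLaplaceExponent_two_mul_sub hs]
  refine (integral_stableLevyMeasure_le (a := s ^ 2) (b := 0) (c := 0) (d := 1) hα
    (hν.integrable_one_sub_exp_neg_sq hs)
    (fun x hx => ?_) (fun x hx => ?_)).trans_eq (by rw [zero_div, zero_div, add_zero, add_zero])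
  · have hle : 1 - Real.exp (-(s * x)) ≤ s * x := by linarith [Real.add_one_le_exp (-(s * x))]
    have hnonneg : 0 ≤ 1 - Real.exp (-(s * x)) :=
      sub_nonneg.mpr (Real.exp_le_one_iff.mpr (neg_nonpos.mpr (mul_nonneg hs hx.1.le)))
    linarith [pow_le_pow_left₀ hnonneg hle 2]
  · have hnonneg : 0 ≤ 1 - Real.exp (-(s * x)) :=
      sub_nonneg.mpr (Real.exp_le_one_iff.mpr
        (neg_nonpos.mpr (mul_nonneg hs (zero_le_one.trans (le_of_lt hx)))))
    have hle : 1 - Real.exp (-(s * x)) ≤ 1 := sub_le_self _ (Real.exp_pos _).le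
    linarith [pow_le_one₀ (n := 2) hnonneg hle]

theorem realLaplaceExponent_stableLevyMeasure_one_le :
    realLaplaceExponent (stableLevyMeasure α) 1 ≤ (1 / (2 - α) + 1 / (α - 1)) / α := by
  have hα₀ : 0 < α := by linarith [hα.1]
  have hα₁ : 0 < α - 1 := sub_pos.mpr hα.1
  have hα₂ : 0 < 2 - α := sub_pos.mpr hα.2
  have hexp : Real.exp (-1) ≤ 1 / 2 :=
    (exp_neg_le_one_sub_add_sq zero_le_one).trans_eq (by norm_num)
  calc realLaplaceExponent (stableLevyMeasure α) 1
      ≤ (1 : ℝ) ^ 2 / 2 / (2 - α) + 1 / (α - 1) + (Real.exp (-1) - 1) / α :=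
        realLaplaceExponent_stableLevyMeasure_le hα zero_le_one
    _ ≤ (1 : ℝ) ^ 2 / 2 / (2 - α) + 1 / (α - 1) + (1 / 2 - 1) / α := by gcongr
    _ = (1 / (2 - α) + 1 / (α - 1)) / α := by
      field_simp
      ring

theorem le_realLaplaceExponent_stableLevyMeasure_one :
    4 / 5 * ((1 / (2 - α) + 1 / (α - 1)) / α) ≤
      realLaplaceExponent (stableLevyMeasure α) 1 := by
  refine le_trans ?_ (le_realLaplaceExponent_stableLevyMeasure hα zero_le_one)
  have hα₀ : 0 < α := by linarith [hα.1]
  have hα₁ : 0 < α - 1 := sub_pos.mpr hα.1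
  have hα₂ : 0 < 2 - α := sub_pos.mpr hα.2
  have hα₃ : 0 < 3 - α := by linarith
  have hdiff : (1 : ℝ) ^ 2 / 2 / (2 - α) - (1 : ℝ) ^ 3 / 6 / (3 - α) + 1 / (α - 1) - 1 / α -
      4 / 5 * ((1 / (2 - α) + 1 / (α - 1)) / α) =
      ((3 - α) * (6 - 15 * ((α - 1) * (2 - α))) - 5 * (α * (α - 1) * (2 - α))) /
        (30 * (α * (α - 1) * (2 - α) * (3 - α))) := by
    field_simp
    ring
  rw [← sub_nonneg, hdiff]
  refine div_nonneg ?_ (by positivity)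
  nlinarith [sq_nonneg (2 * α - 3), mul_pos hα₁ hα₂, mul_pos (mul_pos hα₁ hα₂) hα₀]

end ExponentBounds

section SaddlePoint

/-- The maximizer `(r / D)^{1/(α-1)}` of `s ↦ r s - (D / α) s ^ α`. It is the exponential tilt in
the large deviation bounds for a cumulant generating function of order `(D / α) s ^ α`. -/
noncomputable def saddlePoint (α D r : ℝ) : ℝ :=
  (r / D) ^ (1 / (α - 1))

theorem two_rpow_le_two_mul {α : ℝ} (hα : α ∈ Icc 1 2) : (2 : ℝ) ^ α ≤ 2 * α := by
  have hbernoulli : (2 : ℝ) ^ (α - 1) ≤ α := by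
    have h := rpow_one_add_le_one_add_mul_self (s := 1) (by norm_num)
      (sub_nonneg.mpr hα.1) (by linarith [hα.2] : α - 1 ≤ 1)
    rwa [one_add_one_eq_two, mul_one, add_sub_cancel] at h
  rw [Real.rpow_sub_one two_ne_zero, div_le_iff₀ two_pos] at hbernoulli
  linarith

theorem self_le_two_rpow {p : ℝ} (hp : 1 ≤ p) : p ≤ 2 ^ p := by
  have h := one_add_mul_self_le_rpow_one_add (s := 1) (by norm_num) hp
  rw [one_add_one_eq_two] at h
  linarith

theorem one_half_rpow_le {α : ℝ} (hα : 1 < α) : (1 / 2 : ℝ) ^ (α / (α - 1)) ≤ 1 - 1 / α := by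
  have hα₀ : 0 < α := one_pos.trans hα
  have hα₁ : 0 < α - 1 := sub_pos.mpr hα
  calc (1 / 2 : ℝ) ^ (α / (α - 1)) = (2 ^ (α / (α - 1)))⁻¹ := by
        rw [one_div, Real.inv_rpow zero_le_two]
    _ ≤ (α / (α - 1))⁻¹ := by
        gcongr
        exact self_le_two_rpow ((one_le_div hα₁).mpr (by linarith))
    _ = 1 - 1 / α := by rw [inv_div, sub_div, div_self hα₀.ne']

variable {α D r κ : ℝ}

theorem saddlePoint_pos (hr : 0 < r) (hD : 0 < D) : 0 < saddlePoint α D r :=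
  Real.rpow_pos_of_pos (div_pos hr hD) _

theorem saddlePoint_rpow (hα : 1 < α) (hr : 0 < r) (hD : 0 < D) :
    saddlePoint α D r ^ α = saddlePoint α D r * (r / D) := by
  have hα₁ : α - 1 ≠ 0 := (sub_pos.mpr hα).ne'
  have hrD : 0 < r / D := div_pos hr hD
  rw [saddlePoint, ← Real.rpow_mul hrD.le, ← Real.rpow_add_one hrD.ne']
  congr 1
  field_simp
  ring

theorem mul_saddlePoint (hα : 1 < α) (hr : 0 < r) (hD : 0 < D) :
    r * saddlePoint α D r = r ^ (α / (α - 1)) / D ^ (1 / (α - 1)) := by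
  have hα₁ : α - 1 ≠ 0 := (sub_pos.mpr hα).ne'
  have hp : α / (α - 1) = 1 + 1 / (α - 1) := by
    field_simp
    ring
  rw [hp, Real.rpow_add hr, Real.rpow_one, mul_div_assoc, saddlePoint, Real.div_rpow hr.le hD.le]

theorem mul_saddlePoint_rpow_sub_le (hα : 1 < α) (hr : 0 < r) (hD : 0 < D) (hκ : κ ≤ D / α) :
    κ * saddlePoint α D r ^ α - saddlePoint α D r * r ≤
      -((1 / 2 * r) ^ (α / (α - 1)) / D ^ (1 / (α - 1))) := by
  have hα₀ : α ≠ 0 := (one_pos.trans hα).ne'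
  have hs := saddlePoint_pos (α := α) hr hD
  rw [Real.mul_rpow (by norm_num) hr.le, mul_div_assoc, ← mul_saddlePoint hα hr hD,
    saddlePoint_rpow hα hr hD]
  set s := saddlePoint α D r
  calc κ * (s * (r / D)) - s * r ≤ D / α * (s * (r / D)) - s * r := by gcongr
    _ = -((1 - 1 / α) * (r * s)) := by
        field_simp
        ring
    _ ≤ _ := by
        gcongr
        exact one_half_rpow_le hα

theorem mul_two_mul_saddlePoint_rpow_sub_le (hα : α ∈ Ioo 1 2) (hr : 0 < r) (hD : 0 < D)
    (hκ₀ : 0 ≤ κ) (hκ : κ ≤ D / α) :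
    κ * (2 * saddlePoint α D r) ^ α - 2 * (κ * saddlePoint α D r ^ α) ≤
      r ^ (α / (α - 1)) / D ^ (1 / (α - 1)) := by
  have hα₀ : 0 < α := one_pos.trans hα.1
  have hα₁ : 0 < α - 1 := sub_pos.mpr hα.1
  have hs := saddlePoint_pos (α := α) hr hD
  rw [Real.mul_rpow zero_le_two hs.le, ← mul_saddlePoint hα.1 hr hD, saddlePoint_rpow hα.1 hr hD]
  set s := saddlePoint α D r
  calc κ * (2 ^ α * (s * (r / D))) - 2 * (κ * (s * (r / D)))
      = κ * ((2 ^ α - 2) * (s * (r / D))) := by ring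
    _ ≤ κ * (2 * (α - 1) * (s * (r / D))) := by
        gcongr
        linarith [two_rpow_le_two_mul (Ioo_subset_Icc_self hα)]
    _ ≤ D / α * (2 * (α - 1) * (s * (r / D))) := by gcongr
    _ = 2 * (α - 1) / α * (r * s) := by field_simp
    _ ≤ r * s := by
        refine mul_le_of_le_one_left (mul_pos hr hs).le ((div_le_one hα₀).mpr ?_)
        linarith [hα.2]

end SaddlePoint

theorem four_le_one_div_add_one_div {α : ℝ} (hα : α ∈ Ioo 1 2) :
    4 ≤ 1 / (2 - α) + 1 / (α - 1) := by
  have hα₁ : 0 < α - 1 := sub_pos.mpr hα.1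
  have hα₂ : 0 < 2 - α := sub_pos.mpr hα.2
  rw [div_add_div _ _ hα₂.ne' hα₁.ne', le_div_iff₀ (mul_pos hα₂ hα₁)]
  linarith [sq_nonneg (2 * α - 3)]

theorem saddlePoint_mul_add_one_le {α D κ y : ℝ} (hα : α ∈ Ioo 1 2) (hD : 0 < D)
    (hκ : 4 / 5 * (D / α) ≤ κ) (hs : 9 / 5 ≤ saddlePoint α D (9 / 5 * (y + 1 / (α - 1))))
    (hy : 1 / (2 - α) ≤ y) :
    saddlePoint α D (9 / 5 * (y + 1 / (α - 1))) * (y / 8 + 1 / (α - 1)) + 1 ≤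
      κ * saddlePoint α D (9 / 5 * (y + 1 / (α - 1))) ^ α := by
  have hα₀ : 0 < α := one_pos.trans hα.1
  have hα₁ : 0 < α - 1 := sub_pos.mpr hα.1
  have hy₁ : 1 ≤ y := ((one_le_div (sub_pos.mpr hα.2)).mpr (by linarith)).trans hy
  have hfour : 4 ≤ y + 1 / (α - 1) := (four_le_one_div_add_one_div hα).trans (by gcongr)
  have hgap : y / 8 + 1 / (α - 1) + 5 / 9 ≤ 36 / 25 * (y + 1 / (α - 1)) / α := by
    have hmul : α * (1 / (α - 1)) = 1 + 1 / (α - 1) := by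
      field_simp
      ring
    have hbound : α * (y / 8 + 5 / 9) ≤ 2 * (y / 8 + 5 / 9) := by
      gcongr
      exact hα.2.le
    rw [le_div_iff₀ hα₀]
    linarith
  have hz : 0 < y + 1 / (α - 1) := by linarith
  rw [saddlePoint_rpow hα.1 (mul_pos (by norm_num) hz) hD]
  set s := saddlePoint α D (9 / 5 * (y + 1 / (α - 1)))
  have hs₀ : 0 < s := by linarith
  calc s * (y / 8 + 1 / (α - 1)) + 1 ≤ s * (y / 8 + 1 / (α - 1) + 5 / 9) := by linarith
    _ ≤ s * (36 / 25 * (y + 1 / (α - 1)) / α) := mul_le_mul_of_nonneg_left hgap hs₀.le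
    _ = 4 / 5 * (D / α) * (s * (9 / 5 * (y + 1 / (α - 1)) / D)) := by
        field_simp
        ring
    _ ≤ _ := by gcongr

theorem exp_neg_one_le_one_sub_sq : Real.exp (-1) ≤ (1 - Real.exp (-1)) ^ 2 := by
  have hexp : Real.exp (-1) ≤ 0.37 := Real.exp_neg_one_lt_d9.le.trans (by norm_num)
  nlinarith

theorem nine_fifths_le_sqrt : 9 / 5 ≤ √(4 - 2 / Real.exp 1) := by
  refine Real.le_sqrt_of_sq_le ?_
  rw [div_eq_mul_inv 2, ← Real.exp_neg]
  linarith [Real.exp_neg_one_lt_d9]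

theorem inv_exp_one_sub_le : 1 / Real.exp 1 - 1 / 4 ≤ 1 / 8 := by
  rw [one_div (Real.exp 1), ← Real.exp_neg]
  linarith [Real.exp_neg_one_lt_d9]

namespace IsTotallyAsymmetricStable

variable {Ω : Type*} [MeasurableSpace Ω] {P : Measure Ω} {α : ℝ} {X : Ω → ℝ} {y : ℝ}
  (hX : IsTotallyAsymmetricStable α X P) (hα : α ∈ Ioo 1 2)
include hX hα

theorem measureReal_le_gaussian [IsFiniteMeasure P] (hy : 0 < y) :
    P.real {ω | X ω ≤ -(y + 1 / (α - 1))} ≤ Real.exp (-(1 / 2) * (2 - α) * y ^ 2) := by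
  have hα₀ : 0 < α := one_pos.trans hα.1
  have hα₂ : 0 < 2 - α := sub_pos.mpr hα.2
  have hs : 0 < (2 - α) * y := mul_pos hα₂ hy
  refine (hX.measureReal_le_neg_le hα hs _).trans (Real.exp_le_exp.mpr ?_)
  have hexp : (Real.exp (-((2 - α) * y)) - 1) / α ≤ 0 :=
    div_nonpos_of_nonpos_of_nonneg
      (sub_nonpos.mpr (Real.exp_le_one_iff.mpr (neg_nonpos.mpr hs.le))) hα₀.le
  have hψ := realLaplaceExponent_stableLevyMeasure_le hα hs.le
  rw [show ((2 - α) * y) ^ 2 / 2 / (2 - α) = (2 - α) * y ^ 2 / 2 by field_simp] at hψ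
  linarith [mul_one_div ((2 - α) * y) (α - 1)]

theorem gaussian_le_measureReal [IsProbabilityMeasure P]
    (hy : y ∈ Icc (2 / √(2 - α)) (2 / (2 - α))) :
    Real.exp (-1) * (10 : ℝ) ^ (-2 : ℤ) * Real.exp (-(2 - α) * y ^ 2) ≤
      P.real {ω | X ω ≤ -(1 / 24 * y + 1 / (α - 1))} := by
  have hα₁ : 1 / α ≤ 1 := (div_le_one (one_pos.trans hα.1)).mpr hα.1.le
  have hα₂ : 0 < 2 - α := sub_pos.mpr hα.2
  have hα₃ : 0 < 3 - α := by linarith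
  have hsqrt : 0 < √(2 - α) := Real.sqrt_pos.mpr hα₂
  have hy₀ : 0 < y := (div_pos two_pos hsqrt).trans_le hy.1
  have hs : 0 < (2 - α) * y := mul_pos hα₂ hy₀
  have hs_le : (2 - α) * y ≤ 2 := (le_div_iff₀' hα₂).mp hy.2
  have hq : 4 ≤ (2 - α) * y ^ 2 := by
    have h := pow_le_pow_left₀ zero_le_two ((div_le_iff₀' hsqrt).mp hy.1) 2
    rw [mul_pow, Real.sq_sqrt hα₂.le] at h
    linarith
  have hcube : ((2 - α) * y) ^ 3 / 6 / (3 - α) ≤ (2 - α) * y ^ 2 / 6 := by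
    have hle : (2 - α) * y * (2 - α) ≤ 3 - α := by nlinarith [hα.1]
    rw [div_le_iff₀ hα₃]
    linarith [mul_le_mul_of_nonneg_left hle (by positivity : 0 ≤ (2 - α) * y ^ 2)]
  have hthreshold : (2 - α) * y * (1 / 24 * y + 1 / (α - 1)) + 1 / 6 ≤
      realLaplaceExponent (stableLevyMeasure α) ((2 - α) * y) := by
    have hψ := le_realLaplaceExponent_stableLevyMeasure hα hs.le
    rw [show ((2 - α) * y) ^ 2 / 2 / (2 - α) = (2 - α) * y ^ 2 / 2 by field_simp] at hψ
    linarith [mul_one_div ((2 - α) * y) (α - 1)]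
  have hcost := realLaplaceExponent_stableLevyMeasure_two_mul_sub_le hα hs.le
  rw [show ((2 - α) * y) ^ 2 / (2 - α) = (2 - α) * y ^ 2 by field_simp] at hcost
  have hten : (10 : ℝ) ^ (-2 : ℤ) ≤ (1 - Real.exp (-(1 / 6))) ^ 2 := by
    have hexp := exp_neg_le_one_sub_add_sq (u := 1 / 6) (by norm_num)
    calc (10 : ℝ) ^ (-2 : ℤ) = (1 / 10) ^ 2 := by norm_num
      _ ≤ _ := pow_le_pow_left₀ (by norm_num) (by linarith) 2
  refine le_trans ?_ (hX.le_measureReal_le_neg hα hs (by norm_num) hthreshold)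
  rw [mul_comm (Real.exp (-1)), mul_assoc, ← Real.exp_add]
  gcongr
  linarith

theorem measureReal_le_exp_rpow [IsFiniteMeasure P] {z : ℝ} (hz : 0 < z) :
    P.real {ω | X ω ≤ -z} ≤
      Real.exp (-((1 / 2 * z) ^ (α / (α - 1)) /
        (1 / (2 - α) + 1 / (α - 1)) ^ (1 / (α - 1)))) := by
  have hα₁ : 0 < α - 1 := sub_pos.mpr hα.1
  have hα₂ : 0 < 2 - α := sub_pos.mpr hα.2
  have hD : 0 < 1 / (2 - α) + 1 / (α - 1) := by positivity
  have hs := saddlePoint_pos (α := α) hz hD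
  refine (hX.measureReal_le_neg_le hα hs z).trans (Real.exp_le_exp.mpr ?_)
  rw [realLaplaceExponent_stableLevyMeasure_eq_mul_rpow α hs]
  exact mul_saddlePoint_rpow_sub_le hα.1 hz hD (realLaplaceExponent_stableLevyMeasure_one_le hα)

/-- `9/5` and `1/8` are rational substitutes for `√(4 - 2/e)` and `1/e - 1/4`. -/
theorem exp_rpow_le_measureReal [IsProbabilityMeasure P] (hy : 1 / (2 - α) ≤ y) :
    Real.exp (-1) *
        Real.exp (-((9 / 5 * (y + 1 / (α - 1))) ^ (α / (α - 1)) /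
          (1 / (2 - α) + 1 / (α - 1)) ^ (1 / (α - 1)))) ≤
      P.real {ω | X ω ≤ -(y / 8 + 1 / (α - 1))} := by
  have hα₁ : 0 < α - 1 := sub_pos.mpr hα.1
  have hα₂ : 0 < 2 - α := sub_pos.mpr hα.2
  have hD : 0 < 1 / (2 - α) + 1 / (α - 1) := by positivity
  have hDy : 1 / (2 - α) + 1 / (α - 1) ≤ y + 1 / (α - 1) := by gcongr
  have hr : 0 < 9 / 5 * (y + 1 / (α - 1)) := by linarith
  have hκ := le_realLaplaceExponent_stableLevyMeasure_one hα
  have hκ₀ : 0 ≤ realLaplaceExponent (stableLevyMeasure α) 1 :=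
    le_trans (by have := hα.1; positivity) hκ
  have hcost := mul_two_mul_saddlePoint_rpow_sub_le hα hr hD hκ₀
    (realLaplaceExponent_stableLevyMeasure_one_le hα)
  have hs_ge : 9 / 5 ≤ saddlePoint α (1 / (2 - α) + 1 / (α - 1)) (9 / 5 * (y + 1 / (α - 1))) := by
    have hbase : 9 / 5 ≤ 9 / 5 * (y + 1 / (α - 1)) / (1 / (2 - α) + 1 / (α - 1)) := by
      rw [le_div_iff₀ hD]
      gcongr
    exact hbase.trans (Real.self_le_rpow_of_one_le (by linarith)
      ((one_le_div hα₁).mpr (by linarith)))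
  have hthreshold := saddlePoint_mul_add_one_le hα hD hκ hs_ge hy
  set s := saddlePoint α (1 / (2 - α) + 1 / (α - 1)) (9 / 5 * (y + 1 / (α - 1)))
  have hs : 0 < s := by linarith
  rw [← realLaplaceExponent_stableLevyMeasure_eq_mul_rpow α hs] at hthreshold
  rw [← realLaplaceExponent_stableLevyMeasure_eq_mul_rpow α hs,
    ← realLaplaceExponent_stableLevyMeasure_eq_mul_rpow α (mul_pos two_pos hs)] at hcost
  refine le_trans ?_ (hX.le_measureReal_le_neg hα hs zero_le_one hthreshold)
  gcongr
  exact exp_neg_one_le_one_sub_sq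

end IsTotallyAsymmetricStable

theorem theorem15_general {Ω : Type*} [MeasurableSpace Ω] {P : Measure Ω} [IsProbabilityMeasure P]
    {α : ℝ} (hα : α ∈ Ioo 1 2) {X : Ω → ℝ} (hX : IsTotallyAsymmetricStable α X P) {y : ℝ} :
    (0 < y → P.real {ω | X ω ≤ -y - 1 / (α - 1)} ≤ Real.exp (-(1 / 2) * (2 - α) * y ^ 2)) ∧
    (y ∈ Icc (2 / √(2 - α)) (2 / (2 - α)) →
      Real.exp (-1) * (10 : ℝ) ^ (-2 : ℤ) * Real.exp (-(2 - α) * y ^ 2) ≤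
        P.real {ω | X ω ≤ -(1 / 24) * y - 1 / (α - 1)}) ∧
    (0 < y → P.real {ω | X ω ≤ -y - 1 / (α - 1)} ≤
      Real.exp (-((1 / 2 * (y + 1 / (α - 1))) ^ (α / (α - 1)) /
        (1 / (2 - α) + 1 / (α - 1)) ^ (1 / (α - 1))))) ∧
    (1 / (2 - α) ≤ y →
      Real.exp (-1) *
          Real.exp (-((√(4 - 2 / Real.exp 1) * (y + 1 / (α - 1))) ^ (α / (α - 1)) /
            (1 / (2 - α) + 1 / (α - 1)) ^ (1 / (α - 1)))) ≤
        P.real {ω | X ω ≤ -(1 / Real.exp 1 - 1 / 4) * y - 1 / (α - 1)}) := by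
  have hα₁ : 0 < α - 1 := sub_pos.mpr hα.1
  have hα₂ : 0 < 2 - α := sub_pos.mpr hα.2
  simp only [← neg_add', neg_mul (1 / 24 : ℝ), neg_mul (1 / Real.exp 1 - 1 / 4)]
  refine ⟨hX.measureReal_le_gaussian hα, hX.gaussian_le_measureReal hα,
    fun hy => hX.measureReal_le_exp_rpow hα (by positivity), fun hy => ?_⟩
  have hy₀ : 0 < y := (one_div_pos.mpr hα₂).trans_le hy
  calc _ ≤ Real.exp (-1) *
          Real.exp (-((9 / 5 * (y + 1 / (α - 1))) ^ (α / (α - 1)) /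
            (1 / (2 - α) + 1 / (α - 1)) ^ (1 / (α - 1)))) := by
        have hp : 0 ≤ α / (α - 1) := div_nonneg (one_pos.trans hα.1).le hα₁.le
        gcongr
        exact nine_fifths_le_sqrt
    _ ≤ P.real {ω | X ω ≤ -(y / 8 + 1 / (α - 1))} := hX.exp_rpow_le_measureReal hα hy
    _ ≤ _ := by
        refine measureReal_mono fun ω (hω : X ω ≤ _) => hω.trans ?_
        gcongr
        linarith [mul_le_mul_of_nonneg_right inv_exp_one_sub_le hy₀.le]

theorem theorem15 {Ω : Type*} [MeasurableSpace Ω] (P : Measure Ω) [IsProbabilityMeasure P]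
    (α : ℝ) (hα : α ∈ Set.Ioo (1 : ℝ) 2) (X : Ω → ℝ) (hX : IsTotallyAsymmetricStable α X P) :
    (∀ y ∈ Set.Icc (2 / Real.sqrt (2 - α)) (2 / (2 - α)),
      P.real {ω | X ω ≤ -y - 1 / (α - 1)} ≤
          Real.exp (4 / 3) * Real.exp (-(1 / 2) * (2 - α) * y ^ 2) ∧
      P.real {ω | X ω ≤ -(1 / 24) * y - 1 / (α - 1)} ≥
          Real.exp (-1) * (10 : ℝ) ^ (-2 : ℤ) * Real.exp (-(2 - α) * y ^ 2)) ∧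
    (∀ y : ℝ, 2 / (2 - α) ≤ y →
      P.real {ω | X ω ≤ -y - 1 / (α - 1)} ≤
          Real.exp (-(((1 / 2) * (y + 1 / (α - 1))) ^ (α / (α - 1)) /
            (1 / (2 - α) + 1 / (α - 1)) ^ (1 / (α - 1)))) ∧
      P.real {ω | X ω ≤ -(1 / Real.exp 1 - 1 / 4) * y - 1 / (α - 1)} ≥
          Real.exp (-1) *
            Real.exp (-((Real.sqrt (4 - 2 / Real.exp 1) * (y + 1 / (α - 1))) ^ (α / (α - 1)) /
              (1 / (2 - α) + 1 / (α - 1)) ^ (1 / (α - 1))))) := by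
  have hα₂ : 0 < 2 - α := sub_pos.mpr hα.2
  have h (y : ℝ) := theorem15_general hα hX (y := y)
  refine ⟨fun y hy => ⟨?_, (h y).2.1 hy⟩, fun y hy => ⟨(h y).2.2.1 ?_, (h y).2.2.2 ?_⟩⟩
  · exact ((h y).1 ((by positivity : 0 < 2 / √(2 - α)).trans_le hy.1)).trans
      (le_mul_of_one_le_left (Real.exp_pos _).le (Real.one_le_exp (by norm_num)))
  · exact (div_pos two_pos hα₂).trans_le hy
  · exact le_trans (by gcongr; exact one_le_two) hy
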